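/- Let $\mu$ be a probability distribution on $\{0,1\}^n$. Call $\mu$ \emph{$k$-homogeneous} if $\xi\sim\mu$ has exactly $k$ entries equal to $1$ with probability $1$. For $\Lambda\subseteq[n]$ let $\mathcal I_\mu^\Lambda$ be the $n\times n$ matrix with entries $$\mathcal I_\mu^\Lambda(i,j)=\Pr_{\xi\sim\mu}[\xi_j=1\mid \xi_i=1,\ \xi_\ell=1\ \forall \ell\in\Lambda]-\Pr_{\xi\sim\mu}[\xi_j=1\mid \xi_\ell=1\ \forall \ell\in\Lambda]$$ if the event $\{\xi_\ell=1\ \forall \ell\in\Lambda\cup\{i,j\}\}$ has positive probability, and $\mathcal I_\mu^\Lambda(i,j)=0$ otherwise. Call $\mu$ (one-sided) \emph{$\ell_\infty$-independent with parameter $D$} if $\sum_{j\in[n]}|\mathcal I_\mu^\Lambda(i,j)|\le D$ for all $\Lambda\subseteq[n]$ and all $i\in[n]$. \textbf{Theorem.} There is a universal constant $C>0$ such that the following holds. Let $d\ge 1$, $D>0$ and $R>0$, let $\mu$ be a distribution on $\{0,1\}^n$ that is $k$-homogeneous and $\ell_\infty$-independent with parameter $D$, and let $Y_1,\dots,Y_n\in\mathbb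 R^{d\times d}$ be symmetric matrices with $0\preceq Y_i\preceq R\,I$ for all $i$. Put $\mu_{\min}=\lambda_{\min}\big(\mathbb E_{\xi\sim\mu}\sum_i\xi_iY_i\big)$ and $\mu_{\max}=\lambda_{\max}\big(\mathbb E_{\xi\sim\mu}\sum_i\xi_iY_i\big)$. Then for every $\delta\in[0,1]$, $$\Pr_{\xi\sim\mu}\Big[\lambda_{\min}\Big(\sum_i\xi_iY_i\Big)\le(1-\delta)\mu_{\min}\Big]\le d\,\exp\Big(-\frac{\delta^2\mu_{\min}}{C\,R\,D^2}\Big)$$ and $$\Pr_{\xi\sim\mu}\Big[\lambda_{\max}\Big(\sum_i\xi_iY_i\Big)\ge(1+\delta)\mu_{\max}\Big]\le d\,\exp\Big(-\frac{\delta^2\mu_{\max}}{C\,R\,D^2}\Big).$$ -/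

import Mathlib

open MeasureTheory ProbabilityTheory

noncomputable section

namespace MatrixChernoff

/-- The event `ξ_ℓ = 1` for all `ℓ ∈ Λ`, for `ξ ∈ {0,1}^n` (with `true` for `1`). -/
def allOnes {n : ℕ} (Λ : Finset (Fin n)) : Set (Fin n → Bool) :=
  {ξ | ∀ l ∈ Λ, ξ l = true}

/-- A distribution on `{0,1}^n` is `k`-homogeneous when almost every outcome has exactly
`k` ones. -/
def IsHomogeneous {n : ℕ} (μ : Measure (Fin n → Bool)) (k : ℕ) : Prop :=
  ∀ᵐ ξ ∂μ, (Finset.univ.filter fun i => ξ i = true).card = k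

open Classical in
/-- The one-sided pairwise influence matrix: the `(i, j)` entry is
`P(ξ_j = 1 | ξ_i = 1 and ξ_ℓ = 1 for all ℓ ∈ Λ) - P(ξ_j = 1 | ξ_ℓ = 1 for all ℓ ∈ Λ)` when the
conditioning on `Λ ∪ {i, j}` is feasible, and `0` otherwise. Rows and columns with index
in `Λ` vanish, so the matrix may be indexed by all of `[n]`. -/
def influenceMatrix {n : ℕ} (μ : Measure (Fin n → Bool)) (Λ : Finset (Fin n)) :
    Matrix (Fin n) (Fin n) ℝ :=
  Matrix.of fun i j =>
    if μ (allOnes (Λ ∪ {i, j})) ≠ 0 then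
      (cond μ (allOnes (insert i Λ))).real {ξ | ξ j = true}
        - (cond μ (allOnes Λ)).real {ξ | ξ j = true}
    else 0

/-- (One-sided) `ℓ_∞`-independence with parameter `D`: for every `Λ ⊆ [n]`, every row of the
influence matrix has absolute sum at most `D`. -/
def IsLinftyIndependent {n : ℕ} (μ : Measure (Fin n → Bool)) (D : ℝ) : Prop :=
  ∀ Λ : Finset (Fin n), ∀ i : Fin n, ∑ j : Fin n, |influenceMatrix μ Λ i j| ≤ D

/-- The matrix `∑ i, ξ_i Y_i`. -/
def matrixSum {n d : ℕ} (Y : Fin n → Matrix (Fin d) (Fin d) ℝ) (ξ : Fin n → Bool) :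
    Matrix (Fin d) (Fin d) ℝ :=
  ∑ i : Fin n, (if ξ i = true then (1 : ℝ) else 0) • Y i

/-- The expectation of `∑ i, ξ_i Y_i` for `ξ` distributed as `μ`, taken entrywise. -/
def expectedSum {n d : ℕ} (μ : Measure (Fin n → Bool))
    (Y : Fin n → Matrix (Fin d) (Fin d) ℝ) : Matrix (Fin d) (Fin d) ℝ :=
  Matrix.of fun a b => ∫ ξ, matrixSum Y ξ a b ∂μ

/-- The smallest eigenvalue (used for symmetric matrices of positive size only, whose real
spectrum is the non-empty finite set of eigenvalues). -/
def lambdaMin {d : ℕ} (A : Matrix (Fin d) (Fin d) ℝ) : ℝ := sInf (spectrum ℝ A)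

/-- The largest eigenvalue (used for symmetric matrices of positive size only). -/
def lambdaMax {d : ℕ} (A : Matrix (Fin d) (Fin d) ℝ) : ℝ := sSup (spectrum ℝ A)

end MatrixChernoff

end

/-! Reveal the ones of `ξ` in uniformly random order. When `Λ` is revealed and `p` denotes the
conditional marginals, the next one is `i ∉ Λ` with probability `p i / (k - |Λ|)`, and the marginals
change by the influence row of `i`. By homogeneity these rows sum to zero. By Bayes, `p i * a i j =
p j * a j i`, so the marginals form a martingale, and the row bounds yield weighted column bounds.

The trace exponential of `tiltedSum` is a supermartingale. It interpolates between `β • expectedSum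
μ Y` for `Λ = ∅` and `(β - γ) • matrixSum Y ξ` at the end. In each step Golden–Thompson
(`trace_exp_add_le`) and `e^Z ≤ 1 + Z + Z²` for `Z ≤ 1` leave a second moment, which is at most `K²
R ∑ p j Y j`. The term `-γ` on revealed indices contributes a drift `-γ ∑ p j Y j` that pays for it.
This is `sum_mul_trace_exp_add_sum_smul_le`, applied to influences in
`sum_condMarginal_mul_trace_exp_le`. With `γ` of order `θ² D² R` it gives `integral_trace_exp_le`,
and Markov's inequality with `θ` of order `δ / (D² R)` gives both tails.

The estimates use `D ≥ 1/2`. For smaller `D` the distribution is a point mass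
(`ae_eq_const_of_lt_half`). -/

/-! ### The Lie–Trotter formula -/

open Filter Topology in
theorem norm_pow_sub_pow_le_mul {𝔸 : Type*} [NormedRing 𝔸] [NormOneClass 𝔸] {x y : 𝔸} {r : ℝ}
    (hx : ‖x‖ ≤ r) (hy : ‖y‖ ≤ r) (hr : 1 ≤ r) (N : ℕ) :
    ‖x ^ N - y ^ N‖ ≤ N * r ^ N * ‖x - y‖ := by
  have hr0 : 0 ≤ r := zero_le_one.trans hr
  induction N with
  | zero => simp
  | succ N ih =>
    have hpow : ‖x ^ N‖ ≤ r ^ N := (norm_pow_le x N).trans (by gcongr)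
    have hle : r ^ N ≤ r ^ (N + 1) := pow_le_pow_right₀ hr N.le_succ
    calc ‖x ^ (N + 1) - y ^ (N + 1)‖ = ‖x ^ N * (x - y) + (x ^ N - y ^ N) * y‖ := by
          congr 1; noncomm_ring
      _ ≤ ‖x ^ N‖ * ‖x - y‖ + ‖x ^ N - y ^ N‖ * ‖y‖ :=
          (norm_add_le _ _).trans (add_le_add (norm_mul_le _ _) (norm_mul_le _ _))
      _ ≤ r ^ N * ‖x - y‖ + (N * r ^ N * ‖x - y‖) * r := by gcongr
      _ ≤ r ^ (N + 1) * ‖x - y‖ + (N * r ^ N * ‖x - y‖) * r := by gcongr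
      _ = ((N + 1 : ℕ) : ℝ) * r ^ (N + 1) * ‖x - y‖ := by push_cast; ring

theorem NormedSpace.norm_exp_le_exp_norm {𝔸 : Type*} [NormedRing 𝔸] [NormOneClass 𝔸]
    [NormedAlgebra ℝ 𝔸] [CompleteSpace 𝔸] (x : 𝔸) : ‖exp x‖ ≤ Real.exp ‖x‖ := by
  have h1 := NormedSpace.exp_series_hasSum_exp' (𝕂 := ℝ) x
  have h2 := NormedSpace.exp_series_hasSum_exp' (𝕂 := ℝ) ‖x‖
  rw [Real.exp_eq_exp_ℝ, ← h1.tsum_eq]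
  refine tsum_of_norm_bounded h2 fun n => ?_
  rw [norm_smul, norm_inv, RCLike.norm_natCast, smul_eq_mul]
  gcongr
  exact norm_pow_le x n

open Filter Topology in
/-- The **Lie–Trotter product formula**. -/
theorem NormedSpace.tendsto_exp_mul_exp_pow {𝔸 : Type*} [NormedRing 𝔸] [NormOneClass 𝔸]
    [NormedAlgebra ℝ 𝔸] [CompleteSpace 𝔸] (a b : 𝔸) :
    Tendsto (fun N : ℕ => (exp ((N : ℝ)⁻¹ • a) * exp ((N : ℝ)⁻¹ • b)) ^ N) atTop
      (𝓝 (exp (a + b))) := by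
  let _ : NormedAlgebra ℚ 𝔸 := NormedAlgebra.restrictScalars ℚ ℝ 𝔸
  -- The defect has zero derivative at `0`, so at `t = 1/N` it is `o(1/N)`; telescoping the `N`-th
  -- powers costs only a factor `N`.
  have hd : HasDerivAt (fun t : ℝ => exp (t • a) * exp (t • b) - exp (t • (a + b))) 0 0 := by
    have ha := hasDerivAt_exp_smul_const (𝕂 := ℝ) a 0
    have hb := hasDerivAt_exp_smul_const (𝕂 := ℝ) b 0
    have hab := hasDerivAt_exp_smul_const (𝕂 := ℝ) (a + b) 0
    have h := (ha.mul hb).sub hab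
    simp only [zero_smul, NormedSpace.exp_zero, one_mul, mul_one, sub_self] at h
    exact h
  have ho := hd.isLittleO
  simp only [zero_smul, NormedSpace.exp_zero, sub_zero, mul_one, sub_self, smul_zero] at ho
  have hinv : Tendsto (fun N : ℕ => ((N : ℝ))⁻¹) atTop (𝓝 0) := tendsto_inv_atTop_nhds_zero_nat
  rw [tendsto_iff_norm_sub_tendsto_zero]
  have hlim := (ho.norm_left.comp_tendsto hinv).tendsto_div_nhds_zero.const_mul
    (Real.exp (‖a‖ + ‖b‖))
  rw [mul_zero] at hlim
  refine squeeze_zero' (Eventually.of_forall fun _ => norm_nonneg _) ?_ hlim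
  filter_upwards [eventually_gt_atTop 0] with N hN0
  have hNpos : (0 : ℝ) < N := by exact_mod_cast hN0
  have hsm : ∀ c : 𝔸, ‖(N : ℝ)⁻¹ • c‖ = (N : ℝ)⁻¹ * ‖c‖ := fun c => by
    rw [norm_smul, norm_inv, RCLike.norm_natCast]
  have hr : (1 : ℝ) ≤ Real.exp ((N : ℝ)⁻¹ * (‖a‖ + ‖b‖)) := Real.one_le_exp (by positivity)
  have hx : ‖exp ((N : ℝ)⁻¹ • a) * exp ((N : ℝ)⁻¹ • b)‖ ≤
      Real.exp ((N : ℝ)⁻¹ * (‖a‖ + ‖b‖)) := by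
    refine (norm_mul_le _ _).trans ?_
    rw [mul_add, Real.exp_add, ← hsm, ← hsm]
    gcongr <;> exact norm_exp_le_exp_norm _
  have hy : ‖exp ((N : ℝ)⁻¹ • (a + b))‖ ≤ Real.exp ((N : ℝ)⁻¹ * (‖a‖ + ‖b‖)) := by
    refine (norm_exp_le_exp_norm _).trans ?_
    rw [hsm]
    gcongr
    exact norm_add_le _ _
  have hpow : exp (a + b) = exp ((N : ℝ)⁻¹ • (a + b)) ^ N := by
    rw [← exp_nsmul, ← Nat.cast_smul_eq_nsmul ℝ, smul_smul, mul_inv_cancel₀ hNpos.ne', one_smul]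
  rw [hpow]
  refine (norm_pow_sub_pow_le_mul hx hy hr N).trans (le_of_eq ?_)
  rw [← Real.exp_nat_mul, mul_inv_cancel_left₀ hNpos.ne']
  simp only [Function.comp, div_inv_eq_mul]
  ring

/-! ### Trace power inequalities and Golden–Thompson -/

namespace Matrix

variable {m : Type*} [Fintype m]

theorem trace_mul_transpose_eq_sum (A B : Matrix m m ℝ) :
    (A * Bᵀ).trace = ∑ p : m × m, A p.1 p.2 * B p.1 p.2 := by
  simp [trace, mul_apply, Fintype.sum_prod_type]

theorem trace_mul_self_le (A : Matrix m m ℝ) : (A * A).trace ≤ (A * Aᵀ).trace := by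
  have h := trace_mul_transpose_eq_sum (A - Aᵀ) (A - Aᵀ)
  have h0 : 0 ≤ ((A - Aᵀ) * (A - Aᵀ)ᵀ).trace := h ▸ Finset.sum_nonneg fun _ _ => mul_self_nonneg _
  have e1 : (Aᵀ * A).trace = (A * Aᵀ).trace := trace_mul_comm _ _
  have e2 : (Aᵀ * Aᵀ).trace = (A * A).trace := by rw [← transpose_mul, trace_transpose]
  simp only [transpose_sub, transpose_transpose, sub_mul, mul_sub, trace_sub, e1, e2] at h0
  linarith

theorem two_mul_trace_mul_le {A B : Matrix m m ℝ} (hA : Aᵀ = A) (hB : Bᵀ = B) :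
    2 * (A * B).trace ≤ (A * A).trace + (B * B).trace := by
  have h := trace_mul_transpose_eq_sum (A - B) (A - B)
  have h0 : 0 ≤ ((A - B) * (A - B)ᵀ).trace := h ▸ Finset.sum_nonneg fun _ _ => mul_self_nonneg _
  have e1 : (B * A).trace = (A * B).trace := trace_mul_comm _ _
  simp only [transpose_sub, hA, hB, sub_mul, mul_sub, trace_sub, e1] at h0
  linarith

variable [DecidableEq m]

theorem trace_mul_pow_comm (A B : Matrix m m ℝ) (N : ℕ) :
    ((A * B) ^ N).trace = ((B * A) ^ N).trace := by
  cases N with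
  | zero => simp
  | succ N =>
    have h : SemiconjBy A (B * A) (A * B) := (mul_assoc A B A).symm
    rw [pow_succ, ← mul_assoc, ← (h.pow_right N).eq, trace_mul_comm, ← mul_assoc, ← pow_succ']

/-- The two claims feed each other. For the first at `N + 1`, apply the second to `X = P * Q`,
rotate under the trace, and apply the first to `P ^ 2` and `Q ^ 2`. For the second, apply it to `X *
X`, rotate, and apply the first to `Xᵀ * X` and `X * Xᵀ`; their powers have equal traces, so the
closing `2ab ≤ a² + b²` gives the required bound. -/
theorem trace_mul_pow_two_pow_le (N : ℕ) :
    (∀ P Q : Matrix m m ℝ, Pᵀ = P → Qᵀ = Q →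
      ((P * Q) ^ 2 ^ N).trace ≤ (P ^ 2 ^ N * Q ^ 2 ^ N).trace) ∧
    ∀ X : Matrix m m ℝ, (X ^ 2 ^ (N + 1)).trace ≤ ((X * Xᵀ) ^ 2 ^ N).trace := by
  induction N with
  | zero => exact ⟨fun P Q _ _ => by simp, fun X => by simpa [pow_two] using trace_mul_self_le X⟩
  | succ N ih =>
    obtain ⟨ihPQ, ihX⟩ := ih
    constructor
    · intro P Q hP hQ
      calc ((P * Q) ^ 2 ^ (N + 1)).trace ≤ ((P * Q * (P * Q)ᵀ) ^ 2 ^ N).trace := ihX _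
        _ = ((P * (Q * Q * P)) ^ 2 ^ N).trace := by
          rw [transpose_mul, hP, hQ]; simp only [mul_assoc]
        _ = ((Q ^ 2 * P ^ 2) ^ 2 ^ N).trace := by
          rw [trace_mul_pow_comm]; simp only [pow_two, mul_assoc]
        _ = ((P ^ 2 * Q ^ 2) ^ 2 ^ N).trace := trace_mul_pow_comm _ _ _
        _ ≤ ((P ^ 2) ^ 2 ^ N * (Q ^ 2) ^ 2 ^ N).trace :=
          ihPQ _ _ (by rw [transpose_pow, hP]) (by rw [transpose_pow, hQ])
        _ = _ := by rw [← pow_mul, ← pow_mul, ← pow_succ']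
    · intro X
      have hP : (Xᵀ * X)ᵀ = Xᵀ * X := by rw [transpose_mul, transpose_transpose]
      have hQ : (X * Xᵀ)ᵀ = X * Xᵀ := by rw [transpose_mul, transpose_transpose]
      have h1 : (X ^ 2 ^ (N + 1 + 1)).trace ≤ ((Xᵀ * X) ^ 2 ^ N * (X * Xᵀ) ^ 2 ^ N).trace :=
        calc (X ^ 2 ^ (N + 1 + 1)).trace = ((X * X) ^ 2 ^ (N + 1)).trace := by
              rw [← pow_two, ← pow_mul, ← pow_succ']
          _ ≤ ((X * X * (X * X)ᵀ) ^ 2 ^ N).trace := ihX _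
          _ = ((X * (X * Xᵀ * Xᵀ)) ^ 2 ^ N).trace := by
              rw [transpose_mul]; simp only [mul_assoc]
          _ = ((X * Xᵀ * (Xᵀ * X)) ^ 2 ^ N).trace := by
              rw [trace_mul_pow_comm]; simp only [mul_assoc]
          _ = ((Xᵀ * X * (X * Xᵀ)) ^ 2 ^ N).trace := trace_mul_pow_comm _ _ _
          _ ≤ _ := ihPQ _ _ hP hQ
      have h2 := two_mul_trace_mul_le (A := (Xᵀ * X) ^ 2 ^ N) (B := (X * Xᵀ) ^ 2 ^ N)
        (by rw [transpose_pow, hP]) (by rw [transpose_pow, hQ])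
      rw [← pow_two, ← pow_two, ← pow_mul, ← pow_mul, ← pow_succ,
        trace_mul_pow_comm Xᵀ X] at h2
      linarith

open Filter Topology in
/-- The **Golden–Thompson inequality** for real symmetric matrices. -/
theorem trace_exp_add_le {A B : Matrix m m ℝ} (hA : Aᵀ = A) (hB : Bᵀ = B) :
    (NormedSpace.exp (A + B)).trace ≤ (NormedSpace.exp A * NormedSpace.exp B).trace := by
  rcases isEmpty_or_nonempty m with h | h
  · simp [trace]
  have hlim : Tendsto (fun N : ℕ => (NormedSpace.exp ((N : ℝ)⁻¹ • A) *
      NormedSpace.exp ((N : ℝ)⁻¹ • B)) ^ N) atTop (𝓝 (NormedSpace.exp (A + B))) := by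
    open scoped Matrix.Norms.Operator in
    exact NormedSpace.tendsto_exp_mul_exp_pow A B
  -- Only exponents `2 ^ N` are covered by the trace inequality, so the limit is taken along them.
  have hlim2 := hlim.comp (tendsto_pow_atTop_atTop_of_one_lt (one_lt_two (α := ℕ)))
  have hlim3 := (Continuous.matrix_trace (continuous_id (X := Matrix m m ℝ))).continuousAt.tendsto.comp hlim2
  refine le_of_tendsto hlim3 (Eventually.of_forall fun N => ?_)
  have hexp : ∀ C : Matrix m m ℝ,
      NormedSpace.exp ((((2 ^ N : ℕ) : ℝ))⁻¹ • C) ^ 2 ^ N = NormedSpace.exp C := fun C => by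
    rw [← exp_nsmul, ← Nat.cast_smul_eq_nsmul ℝ, smul_smul, mul_inv_cancel₀ (by positivity),
      one_smul]
  have h := (trace_mul_pow_two_pow_le (m := m) N).1
    (NormedSpace.exp ((((2 ^ N : ℕ) : ℝ))⁻¹ • A)) (NormedSpace.exp ((((2 ^ N : ℕ) : ℝ))⁻¹ • B))
    (by rw [← exp_transpose, transpose_smul, hA]) (by rw [← exp_transpose, transpose_smul, hB])
  rw [hexp, hexp] at h
  exact h

end Matrix

/-! ### Semidefinite bounds for exponentials and squares -/

namespace Matrix

variable {m : Type*} [Fintype m]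

/-- The quadratic form of a sum of matrices with real coefficients. -/
theorem dotProduct_sum_smul_mulVec {ι : Type*} (s : Finset ι) (c : ι → ℝ) (A : ι → Matrix m m ℝ)
    (x : m → ℝ) : x ⬝ᵥ (∑ i ∈ s, c i • A i) *ᵥ x = ∑ i ∈ s, c i * (x ⬝ᵥ A i *ᵥ x) := by
  simp [sum_mulVec, smul_mulVec, dotProduct_sum]

theorem dotProduct_mul_self_mulVec {A : Matrix m m ℝ} (hA : Aᵀ = A) (x : m → ℝ) :
    x ⬝ᵥ (A * A) *ᵥ x = (A *ᵥ x) ⬝ᵥ (A *ᵥ x) := by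
  rw [← mulVec_mulVec, dotProduct_mulVec, ← mulVec_transpose, hA]

variable [DecidableEq m]

theorem IsHermitian.exists_diagonalization {A : Matrix m m ℝ} (hA : A.IsHermitian) :
    ∃ U : Matrix m m ℝ, U * Uᵀ = 1 ∧ Uᵀ * U = 1 ∧ A = U * diagonal hA.eigenvalues * Uᵀ := by
  refine ⟨hA.eigenvectorUnitary, ?_, ?_, ?_⟩
  · exact Unitary.coe_mul_star_self hA.eigenvectorUnitary
  · exact Unitary.coe_star_mul_self hA.eigenvectorUnitary
  · have h := hA.spectral_theorem
    rwa [Unitary.conjStarAlgAut_apply] at h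

theorem exp_orthogonal_conj {U : Matrix m m ℝ} (hU : U * Uᵀ = 1) (v : m → ℝ) :
    NormedSpace.exp (U * diagonal v * Uᵀ) = U * diagonal (fun i => Real.exp (v i)) * Uᵀ := by
  have hinv : U⁻¹ = Uᵀ := inv_eq_right_inv hU
  have hunit : IsUnit U := IsUnit.of_mul_eq_one _ hU
  rw [← hinv, exp_conj _ _ hunit, exp_diagonal,
    show NormedSpace.exp v = fun i => Real.exp (v i) by
      funext i; rw [Pi.coe_exp, Real.exp_eq_exp_ℝ]]

theorem PosSemidef.exp {A : Matrix m m ℝ} (hA : A.IsHermitian) :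
    (NormedSpace.exp A).PosSemidef := by
  obtain ⟨U, hU, -, hAU⟩ := hA.exists_diagonalization
  rw [hAU, exp_orthogonal_conj hU]
  exact (PosSemidef.diagonal fun i => (Real.exp_pos _).le).mul_mul_conjTranspose_same U

theorem PosSemidef.trace_mul_nonneg {A B : Matrix m m ℝ} (hA : A.PosSemidef)
    (hB : B.PosSemidef) : 0 ≤ (A * B).trace := by
  obtain ⟨U, -, -, hAU⟩ := hA.1.exists_diagonalization
  have h : (A * B).trace = (diagonal hA.1.eigenvalues * (Uᵀ * B * U)).trace := by
    conv_lhs => rw [hAU]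
    rw [mul_assoc, mul_assoc, trace_mul_comm]
    simp only [mul_assoc]
  have hC : (Uᵀ * B * U).PosSemidef := hB.conjTranspose_mul_mul_same U
  rw [h, trace]
  refine Finset.sum_nonneg fun i _ => ?_
  rw [diag_apply, diagonal_mul]
  exact mul_nonneg (hA.eigenvalues_nonneg i) hC.diag_nonneg

/-- Below `-1` one has `e^x ≤ 1 ≤ 1 + x + x²`, so no lower bound on the perturbation is ever needed.
-/
theorem _root_.Real.exp_le_one_add_add_sq {x : ℝ} (hx : x ≤ 1) :
    Real.exp x ≤ 1 + x + x ^ 2 := by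
  rcases le_or_gt (-1) x with h | h
  · have := Real.abs_exp_sub_one_sub_id_le (x := x) (abs_le.2 ⟨h, hx⟩)
    linarith [le_abs_self (Real.exp x - 1 - x)]
  · have := Real.exp_le_one_iff.2 (show x ≤ 0 by linarith)
    nlinarith

theorem IsHermitian.posSemidef_one_add_add_sq_sub_exp {Z : Matrix m m ℝ} (hZ : Z.IsHermitian)
    (h1 : (1 - Z).PosSemidef) : (1 + (Z + Z * Z) - NormedSpace.exp Z).PosSemidef := by
  obtain ⟨U, hU, hU', hZU⟩ := hZ.exists_diagonalization
  set v := hZ.eigenvalues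
  have hv : ∀ i, v i ≤ 1 := by
    have h2 := h1.conjTranspose_mul_mul_same U
    have h3 : Uᴴ * (1 - Z) * U = diagonal fun i => 1 - v i := by
      change Uᵀ * (1 - Z) * U = _
      have h4 : Uᵀ * Z * U = diagonal v := by
        rw [hZU, ← mul_assoc, ← mul_assoc, hU', one_mul, mul_assoc, hU', mul_one]
      rw [mul_sub, sub_mul, h4, mul_one, hU', ← diagonal_one, diagonal_sub]
    rw [h3, posSemidef_diagonal_iff] at h2
    exact fun i => sub_nonneg.1 (h2 i)
  have hsq : Z * Z = U * diagonal (fun i => v i ^ 2) * Uᵀ := by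
    calc Z * Z = U * diagonal v * (Uᵀ * U) * diagonal v * Uᵀ := by
          conv_lhs => rw [hZU]
          simp only [mul_assoc]
      _ = _ := by
          rw [hU', mul_one, mul_assoc U, diagonal_mul_diagonal]; simp only [pow_two]
  have hall : 1 + (Z + Z * Z) - NormedSpace.exp Z =
      U * diagonal (fun i => 1 + v i + v i ^ 2 - Real.exp (v i)) * Uᵀ := by
    have he : NormedSpace.exp Z = U * diagonal (fun i => Real.exp (v i)) * Uᵀ := by
      rw [hZU, exp_orthogonal_conj hU]
    have h1 : (1 : Matrix m m ℝ) = U * diagonal (fun _ => 1) * Uᵀ := by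
      rw [diagonal_one, mul_one, hU]
    rw [hsq, he]
    conv_lhs => rw [h1, hZU]
    simp only [← mul_add, ← add_mul, ← mul_sub, ← sub_mul, diagonal_add, diagonal_sub, add_assoc]
  rw [hall]
  exact (PosSemidef.diagonal fun i => sub_nonneg.2
    (Real.exp_le_one_add_add_sq (hv i))).mul_mul_conjTranspose_same U

/-- The trace exponential does not increase in expectation under a random perturbation `Z i`, of
weight `p i`, that is bounded above by `1` and whose drift compensates its second moment. -/
theorem sum_mul_trace_exp_add_le {ι : Type*} {s : Finset ι} {p : ι → ℝ} {H : Matrix m m ℝ}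
    {Z : ι → Matrix m m ℝ} (hp : ∀ i ∈ s, 0 ≤ p i) (hH : H.IsHermitian)
    (hZ : ∀ i ∈ s, (Z i).IsHermitian) (hZ1 : ∀ i ∈ s, p i ≠ 0 → (1 - Z i).PosSemidef)
    (hdrift : (-∑ i ∈ s, p i • (Z i + Z i * Z i)).PosSemidef) :
    ∑ i ∈ s, p i * (NormedSpace.exp (H + Z i)).trace ≤
      (∑ i ∈ s, p i) * (NormedSpace.exp H).trace := by
  have hE := PosSemidef.exp hH
  have hi : ∀ i ∈ s, p i * (NormedSpace.exp (H + Z i)).trace ≤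
      p i * (NormedSpace.exp H).trace + (NormedSpace.exp H * (p i • (Z i + Z i * Z i))).trace := by
    intro i his
    rcases eq_or_ne (p i) 0 with h0 | h0
    · simp [h0]
    have h1 := trace_exp_add_le (A := H) (B := Z i) hH (hZ i his)
    have h2 := hE.trace_mul_nonneg ((hZ i his).posSemidef_one_add_add_sq_sub_exp (hZ1 i his h0))
    rw [mul_sub, trace_sub, mul_add, mul_one, trace_add] at h2
    rw [mul_smul_comm, trace_smul, smul_eq_mul, ← mul_add]
    exact mul_le_mul_of_nonneg_left (by linarith) (hp i his)
  have h3 := hE.trace_mul_nonneg hdrift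
  rw [mul_neg, trace_neg, Finset.mul_sum, trace_sum] at h3
  calc _ ≤ _ := Finset.sum_le_sum hi
    _ ≤ _ := by rw [Finset.sum_add_distrib, ← Finset.sum_mul]; linarith

/-- From `R (R Y - Y²) = Y (R - Y) Y + (R - Y) Y (R - Y)`, a sum of congruences of semidefinite
matrices. -/
theorem PosSemidef.smul_sub_mul_self {Y : Matrix m m ℝ} {R : ℝ} (hR : 0 < R) (hY : Y.PosSemidef)
    (hYR : (R • (1 : Matrix m m ℝ) - Y).PosSemidef) : (R • Y - Y * Y).PosSemidef := by
  have h1 := hYR.conjTranspose_mul_mul_same Y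
  have h2 := hY.conjTranspose_mul_mul_same (R • (1 : Matrix m m ℝ) - Y)
  rw [hY.1.eq] at h1
  rw [hYR.1.eq] at h2
  have h3 := (h1.add h2).smul (inv_nonneg.2 hR.le)
  convert! h3 using 1
  have h4 : Y * (R • (1 : Matrix m m ℝ) - Y) * Y +
      (R • (1 : Matrix m m ℝ) - Y) * Y * (R • (1 : Matrix m m ℝ) - Y) = R • (R • Y - Y * Y) := by
    simp only [mul_sub, sub_mul, mul_smul_comm, smul_mul_assoc, mul_one, one_mul, smul_sub]
    abel
  rw [h4, smul_smul, inv_mul_cancel₀ hR.ne', one_smul]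

theorem dotProduct_mul_self_mulVec_le {Y : Matrix m m ℝ} {R : ℝ} (hR : 0 < R) (hY : Y.PosSemidef)
    (hYR : (R • (1 : Matrix m m ℝ) - Y).PosSemidef) (x : m → ℝ) :
    x ⬝ᵥ (Y * Y) *ᵥ x ≤ R * (x ⬝ᵥ Y *ᵥ x) := by
  have h := (hY.smul_sub_mul_self hR hYR).dotProduct_mulVec_nonneg x
  rw [star_trivial, sub_mulVec, dotProduct_sub, smul_mulVec, dotProduct_smul, smul_eq_mul] at h
  linarith

/-- The square of a linear combination of matrices `0 ≤ Y j ≤ R` is controlled by the combination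
with absolute coefficients. -/
theorem dotProduct_sum_smul_mul_self_mulVec_le {ι : Type*} {s : Finset ι} {a : ι → ℝ}
    {Y : ι → Matrix m m ℝ} {R : ℝ} (hR : 0 < R) (hY : ∀ j ∈ s, (Y j).PosSemidef)
    (hYR : ∀ j ∈ s, (R • (1 : Matrix m m ℝ) - Y j).PosSemidef) (x : m → ℝ) :
    x ⬝ᵥ ((∑ j ∈ s, a j • Y j) * ∑ j ∈ s, a j • Y j) *ᵥ x ≤
      (∑ j ∈ s, |a j|) * (R * ∑ j ∈ s, |a j| * (x ⬝ᵥ Y j *ᵥ x)) := by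
  have hsymm : (∑ j ∈ s, a j • Y j)ᵀ = ∑ j ∈ s, a j • Y j := by
    rw [transpose_sum]
    exact Finset.sum_congr rfl fun j hj => by rw [transpose_smul, show (Y j)ᵀ = Y j from (hY j hj).1]
  -- Cauchy–Schwarz in each coordinate, with weights `|a j|`.
  have hcoord : ∀ c, ((∑ j ∈ s, a j • Y j) *ᵥ x) c ^ 2 ≤
      (∑ j ∈ s, |a j|) * ∑ j ∈ s, |a j| * (Y j *ᵥ x) c ^ 2 := by
    intro c
    rw [sum_mulVec, Finset.sum_apply]
    refine Finset.sum_sq_le_sum_mul_sum_of_sq_le_mul s (fun _ _ => abs_nonneg _)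
      (fun _ _ => by positivity) fun j _ => le_of_eq ?_
    rw [smul_mulVec, Pi.smul_apply, smul_eq_mul, mul_pow, ← sq_abs (a j)]
    ring
  rw [dotProduct_mul_self_mulVec hsymm]
  calc ((∑ j ∈ s, a j • Y j) *ᵥ x) ⬝ᵥ ((∑ j ∈ s, a j • Y j) *ᵥ x)
      = ∑ c, ((∑ j ∈ s, a j • Y j) *ᵥ x) c ^ 2 := by simp only [dotProduct, pow_two]
    _ ≤ ∑ c, (∑ j ∈ s, |a j|) * ∑ j ∈ s, |a j| * (Y j *ᵥ x) c ^ 2 :=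
        Finset.sum_le_sum fun c _ => hcoord c
    _ = (∑ j ∈ s, |a j|) * ∑ j ∈ s, |a j| * (x ⬝ᵥ (Y j * Y j) *ᵥ x) := by
        rw [← Finset.mul_sum, Finset.sum_comm]
        congr 1
        refine Finset.sum_congr rfl fun j hj => ?_
        rw [← Finset.mul_sum, dotProduct_mul_self_mulVec (show (Y j)ᵀ = Y j from (hY j hj).1)]
        simp only [dotProduct, pow_two]
    _ ≤ (∑ j ∈ s, |a j|) * ∑ j ∈ s, |a j| * (R * (x ⬝ᵥ Y j *ᵥ x)) := by
        gcongr with j hj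
        exact dotProduct_mul_self_mulVec_le hR (hY j hj) (hYR j hj) x
    _ = _ := by
        congr 1
        rw [Finset.mul_sum]
        exact Finset.sum_congr rfl fun j _ => by ring

theorem IsHermitian.trace_exp_smul {A : Matrix m m ℝ} (hA : A.IsHermitian) (t : ℝ) :
    (NormedSpace.exp (t • A)).trace = ∑ i, Real.exp (t * hA.eigenvalues i) := by
  obtain ⟨U, hU, hU', hAU⟩ := hA.exists_diagonalization
  have h : t • A = U * diagonal (fun i => t * hA.eigenvalues i) * Uᵀ := by
    conv_lhs => rw [hAU]
    rw [← smul_mul_assoc, ← mul_smul_comm, ← diagonal_smul]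
    rfl
  rw [h, exp_orthogonal_conj hU, trace_mul_comm, ← mul_assoc, hU', one_mul, trace_diagonal]

end Matrix

/-! ### Extreme eigenvalues against the trace exponential -/

namespace MatrixChernoff

open Matrix

variable {d : ℕ} {A : Matrix (Fin d) (Fin d) ℝ}

theorem finite_spectrum (A : Matrix (Fin d) (Fin d) ℝ) : (spectrum ℝ A).Finite :=
  A.finite_real_spectrum

theorem lambdaMin_le_eigenvalues (hA : A.IsHermitian) (i : Fin d) :
    lambdaMin A ≤ hA.eigenvalues i :=
  csInf_le (finite_spectrum A).bddBelow (hA.eigenvalues_mem_spectrum_real i)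

theorem eigenvalues_le_lambdaMax (hA : A.IsHermitian) (i : Fin d) :
    hA.eigenvalues i ≤ lambdaMax A :=
  le_csSup (finite_spectrum A).bddAbove (hA.eigenvalues_mem_spectrum_real i)

theorem spectrum_nonempty (hd : 0 < d) (hA : A.IsHermitian) : (spectrum ℝ A).Nonempty :=
  ⟨_, hA.eigenvalues_mem_spectrum_real ⟨0, hd⟩⟩

theorem exists_eigenvalues_eq_lambdaMin (hd : 0 < d) (hA : A.IsHermitian) :
    ∃ i, hA.eigenvalues i = lambdaMin A := by
  have h := hA.spectrum_real_eq_range_eigenvalues.subset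
    ((spectrum_nonempty hd hA).csInf_mem (finite_spectrum A))
  exact h

theorem exists_eigenvalues_eq_lambdaMax (hd : 0 < d) (hA : A.IsHermitian) :
    ∃ i, hA.eigenvalues i = lambdaMax A := by
  have h := hA.spectrum_real_eq_range_eigenvalues.subset
    ((spectrum_nonempty hd hA).csSup_mem (finite_spectrum A))
  exact h

theorem exp_mul_lambdaMin_le_trace (hd : 0 < d) (hA : A.IsHermitian) (t : ℝ) :
    Real.exp (t * lambdaMin A) ≤ (NormedSpace.exp (t • A)).trace := by
  obtain ⟨i, hi⟩ := exists_eigenvalues_eq_lambdaMin hd hA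
  rw [hA.trace_exp_smul, ← hi]
  exact Finset.single_le_sum (f := fun i => Real.exp (t * hA.eigenvalues i))
    (fun _ _ => (Real.exp_pos _).le) (Finset.mem_univ i)

theorem exp_mul_lambdaMax_le_trace (hd : 0 < d) (hA : A.IsHermitian) (t : ℝ) :
    Real.exp (t * lambdaMax A) ≤ (NormedSpace.exp (t • A)).trace := by
  obtain ⟨i, hi⟩ := exists_eigenvalues_eq_lambdaMax hd hA
  rw [hA.trace_exp_smul, ← hi]
  exact Finset.single_le_sum (f := fun i => Real.exp (t * hA.eigenvalues i))
    (fun _ _ => (Real.exp_pos _).le) (Finset.mem_univ i)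

theorem trace_exp_smul_le_lambdaMax (hA : A.IsHermitian) {t : ℝ} (ht : 0 ≤ t) :
    (NormedSpace.exp (t • A)).trace ≤ d * Real.exp (t * lambdaMax A) := by
  rw [hA.trace_exp_smul]
  refine (Finset.sum_le_card_nsmul _ _ (Real.exp (t * lambdaMax A)) fun i _ => ?_).trans_eq
    (by simp)
  exact Real.exp_le_exp.2 (mul_le_mul_of_nonneg_left (eigenvalues_le_lambdaMax hA i) ht)

theorem trace_exp_smul_le_lambdaMin (hA : A.IsHermitian) {t : ℝ} (ht : t ≤ 0) :
    (NormedSpace.exp (t • A)).trace ≤ d * Real.exp (t * lambdaMin A) := by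
  rw [hA.trace_exp_smul]
  refine (Finset.sum_le_card_nsmul _ _ (Real.exp (t * lambdaMin A)) fun i _ => ?_).trans_eq
    (by simp)
  exact Real.exp_le_exp.2 (mul_le_mul_of_nonpos_left (lambdaMin_le_eigenvalues hA i) ht)

theorem lambdaMin_nonneg (hd : 0 < d) (hA : A.PosSemidef) : 0 ≤ lambdaMin A := by
  obtain ⟨i, hi⟩ := exists_eigenvalues_eq_lambdaMin hd hA.1
  exact hi ▸ hA.eigenvalues_nonneg i

theorem lambdaMax_nonneg (hd : 0 < d) (hA : A.PosSemidef) : 0 ≤ lambdaMax A := by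
  obtain ⟨i, hi⟩ := exists_eigenvalues_eq_lambdaMax hd hA.1
  exact hi ▸ hA.eigenvalues_nonneg i

end MatrixChernoff

/-! ### Perturbation by a random linear combination of the `Y j` -/

namespace Matrix

variable {m : Type*} [Fintype m] [DecidableEq m]

/-- One step of the trace exponential supermartingale: the perturbation is a random linear
combination of matrices `0 ≤ Y j ≤ R`, with coefficient matrix `c` of bounded row sums and bounded
weighted column sums, whose mean is `-γ ∑ j, p j Y j`. -/
theorem sum_mul_trace_exp_add_sum_smul_le {ι : Type*} {s : Finset ι} {p : ι → ℝ}
    {c : ι → ι → ℝ} {Y : ι → Matrix m m ℝ} {H : Matrix m m ℝ} {K R γ : ℝ} (hR : 0 < R)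
    (hK : 0 ≤ K) (hKR : K * R ≤ 1) (hγ : K ^ 2 * R ≤ γ)
    (hY : ∀ j, (Y j).PosSemidef) (hYR : ∀ j, (R • (1 : Matrix m m ℝ) - Y j).PosSemidef)
    (hH : H.IsHermitian) (hp : ∀ i ∈ s, 0 ≤ p i)
    (hrow : ∀ i ∈ s, p i ≠ 0 → ∑ j ∈ s, |c i j| ≤ K)
    (hcol : ∀ j ∈ s, ∑ i ∈ s, p i * |c i j| ≤ K * p j)
    (hmean : ∀ j ∈ s, ∑ i ∈ s, p i * c i j = -γ * p j) :
    ∑ i ∈ s, p i * (NormedSpace.exp (H + ∑ j ∈ s, c i j • Y j)).trace ≤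
      (∑ i ∈ s, p i) * (NormedSpace.exp H).trace := by
  have hZ : ∀ i ∈ s, (∑ j ∈ s, c i j • Y j).IsHermitian := fun i _ => by
    rw [IsHermitian, conjTranspose_sum]
    exact Finset.sum_congr rfl fun j _ => by
      rw [conjTranspose_smul, (hY j).1.eq, star_trivial]
  have hq : ∀ j x, 0 ≤ x ⬝ᵥ Y j *ᵥ x := fun j x => by
    simpa using (hY j).dotProduct_mulVec_nonneg x
  have hqR : ∀ j x, x ⬝ᵥ Y j *ᵥ x ≤ R * (x ⬝ᵥ x) := fun j x => by
    have h := (hYR j).dotProduct_mulVec_nonneg x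
    rw [star_trivial, sub_mulVec, dotProduct_sub, smul_mulVec, dotProduct_smul, smul_eq_mul,
      one_mulVec] at h
    linarith
  refine sum_mul_trace_exp_add_le hp hH hZ (fun i hi hpi => ?_) ?_
  · refine PosSemidef.of_dotProduct_mulVec_nonneg (isHermitian_one.sub (hZ i hi)) fun x => ?_
    have hxx : 0 ≤ x ⬝ᵥ x := Finset.sum_nonneg fun _ _ => mul_self_nonneg _
    rw [star_trivial, sub_mulVec, one_mulVec, dotProduct_sub, dotProduct_sum_smul_mulVec,
      sub_nonneg]
    calc ∑ j ∈ s, c i j * (x ⬝ᵥ Y j *ᵥ x) ≤ ∑ j ∈ s, |c i j| * (R * (x ⬝ᵥ x)) :=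
          Finset.sum_le_sum fun j _ => mul_le_mul (le_abs_self _) (hqR j x) (hq j x) (abs_nonneg _)
      _ = (∑ j ∈ s, |c i j|) * (R * (x ⬝ᵥ x)) := by rw [Finset.sum_mul]
      _ ≤ K * (R * (x ⬝ᵥ x)) := by gcongr; exact hrow i hi hpi
      _ = K * R * (x ⬝ᵥ x) := by ring
      _ ≤ x ⬝ᵥ x := mul_le_of_le_one_left hxx hKR
  · refine PosSemidef.of_dotProduct_mulVec_nonneg ?_ fun x => ?_
    · refine IsHermitian.neg ?_
      rw [IsHermitian, conjTranspose_sum]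
      refine Finset.sum_congr rfl fun i hi => ?_
      rw [conjTranspose_smul, conjTranspose_add, conjTranspose_mul, (hZ i hi).eq, star_trivial]
    · rw [star_trivial, neg_mulVec, dotProduct_neg, dotProduct_sum_smul_mulVec, neg_nonneg]
      have hi : ∀ i ∈ s, p i * (x ⬝ᵥ (∑ j ∈ s, c i j • Y j +
          (∑ j ∈ s, c i j • Y j) * ∑ j ∈ s, c i j • Y j) *ᵥ x) ≤
          ∑ j ∈ s, (p i * c i j + K * R * (p i * |c i j|)) * (x ⬝ᵥ Y j *ᵥ x) := by
        intro i hi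
        rcases eq_or_ne (p i) 0 with h0 | h0
        · simp [h0]
        rw [add_mulVec, dotProduct_add, dotProduct_sum_smul_mulVec]
        have h1 := dotProduct_sum_smul_mul_self_mulVec_le (s := s) (a := c i) hR
          (fun j _ => hY j) (fun j _ => hYR j) x
        have h2 : (∑ j ∈ s, |c i j|) * (R * ∑ j ∈ s, |c i j| * (x ⬝ᵥ Y j *ᵥ x)) ≤
            K * (R * ∑ j ∈ s, |c i j| * (x ⬝ᵥ Y j *ᵥ x)) := by
          refine mul_le_mul_of_nonneg_right (hrow i hi h0) (mul_nonneg hR.le ?_)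
          exact Finset.sum_nonneg fun j _ => mul_nonneg (abs_nonneg _) (hq j x)
        refine (mul_le_mul_of_nonneg_left (add_le_add_right (h1.trans h2) _) (hp i hi)).trans_eq ?_
        simp only [mul_add, Finset.mul_sum, ← Finset.sum_add_distrib]
        exact Finset.sum_congr rfl fun j _ => by ring
      refine (Finset.sum_le_sum hi).trans ?_
      rw [Finset.sum_comm]
      refine Finset.sum_nonpos fun j hj => ?_
      rw [← Finset.sum_mul, Finset.sum_add_distrib, ← Finset.mul_sum, hmean j hj]
      refine mul_nonpos_of_nonpos_of_nonneg ?_ (hq j x)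
      -- The second moment costs `K R * (K p j)`, and `K ^ 2 * R ≤ γ` lets the drift `-γ p j` absorb
      -- it.
      have h1 := mul_le_mul_of_nonneg_left (hcol j hj) (mul_nonneg hK hR.le)
      have h2 := mul_le_mul_of_nonneg_right hγ (hp j hj)
      linarith

end Matrix

/-! ### Conditional marginals and influences -/

namespace MatrixChernoff

variable {ι : Type*} [DecidableEq ι]

/-- For `P Λ` the probability of the event indexed by `Λ`, the conditional probability of `j`
given `Λ`. -/
noncomputable def condMarginal (P : Finset ι → ℝ) (Λ : Finset ι) (j : ι) : ℝ := P (insert j Λ) / P Λ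

section influence

variable {P : Finset ι → ℝ} {Λ : Finset ι} {k D : ℝ}

theorem condMarginal_mul_condMarginal_insert (hP0 : ∀ Λ, 0 ≤ P Λ) (hP : Antitone P) (i j : ι) :
    condMarginal P Λ i * condMarginal P (insert i Λ) j = P (insert j (insert i Λ)) / P Λ := by
  unfold condMarginal
  rcases (hP0 (insert i Λ)).eq_or_lt with h | h
  · have h1 : P (insert j (insert i Λ)) = 0 :=
      le_antisymm (h ▸ hP (Finset.subset_insert _ _)) (hP0 _)
    rw [← h, h1]; simp
  · field_simp

/-- Both sides are the conditional covariance of the events `i` and `j`. This reversibility turns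
statements on rows into statements on weighted columns. -/
theorem condMarginal_mul_influence_symm (hP0 : ∀ Λ, 0 ≤ P Λ) (hP : Antitone P) (i j : ι) :
    condMarginal P Λ i * (condMarginal P (insert i Λ) j - condMarginal P Λ j) =
      condMarginal P Λ j * (condMarginal P (insert j Λ) i - condMarginal P Λ i) := by
  rw [mul_sub, mul_sub, condMarginal_mul_condMarginal_insert hP0 hP,
    condMarginal_mul_condMarginal_insert hP0 hP, Finset.insert_comm,
    mul_comm (condMarginal P Λ i) (condMarginal P Λ j)]

theorem condMarginal_of_mem (hΛ : P Λ ≠ 0) {j : ι} (hj : j ∈ Λ) : condMarginal P Λ j = 1 := by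
  rw [condMarginal, Finset.insert_eq_of_mem hj, div_self hΛ]

variable [Fintype ι]

theorem sum_condMarginal (hk : ∀ Λ, ∑ i, P (insert i Λ) = k * P Λ) (hΛ : P Λ ≠ 0) :
    ∑ i, condMarginal P Λ i = k := by
  unfold condMarginal
  rw [← Finset.sum_div, hk, mul_div_cancel_right₀ _ hΛ]

theorem sum_compl_condMarginal (hk : ∀ Λ, ∑ i, P (insert i Λ) = k * P Λ) (hΛ : P Λ ≠ 0) :
    ∑ i ∈ Λᶜ, condMarginal P Λ i = k - Λ.card := by
  have h := sum_condMarginal hk hΛ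
  rw [← Finset.sum_add_sum_compl Λ, Finset.sum_congr rfl fun j hj => condMarginal_of_mem hΛ hj] at h
  simp only [Finset.sum_const, nsmul_eq_mul, mul_one] at h
  linarith

/-- Homogeneity controls the entries of the influence row with infeasible column. -/
theorem sum_abs_influence_le (hP0 : ∀ Λ, 0 ≤ P Λ) (hk : ∀ Λ, ∑ i, P (insert i Λ) = k * P Λ)
    {i : ι} (hΛ : P Λ ≠ 0) (hi : P (insert i Λ) ≠ 0)
    (hD : ∑ j with P (insert j (insert i Λ)) ≠ 0,
      |condMarginal P (insert i Λ) j - condMarginal P Λ j| ≤ D) :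
    ∑ j, |condMarginal P (insert i Λ) j - condMarginal P Λ j| ≤ 2 * D := by
  set a : ι → ℝ := fun j => condMarginal P (insert i Λ) j - condMarginal P Λ j
  -- Both families of conditional marginals sum to `k`.
  have h0 : ∑ j, a j = 0 := by
    rw [Finset.sum_sub_distrib, sum_condMarginal hk hΛ, sum_condMarginal hk hi, sub_self]
  rw [← Finset.sum_filter_add_sum_filter_not Finset.univ
    (fun j => P (insert j (insert i Λ)) ≠ 0)] at h0 ⊢
  -- Infeasible columns have entries `-condMarginal P Λ j ≤ 0`. As the row sums to zero, their
  -- absolute sum equals the feasible sum, hence is at most `D`; this is the source of the factor 2.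
  have h1 : ∑ j with ¬P (insert j (insert i Λ)) ≠ 0, |a j| =
      -∑ j with ¬P (insert j (insert i Λ)) ≠ 0, a j := by
    rw [← Finset.sum_neg_distrib]
    refine Finset.sum_congr rfl fun j hj => abs_of_nonpos ?_
    have hj' : P (insert j (insert i Λ)) = 0 := by simpa using hj
    have : a j = -condMarginal P Λ j := by simp [a, condMarginal, hj']
    rw [this, neg_nonpos]
    exact div_nonneg (hP0 _) (hP0 _)
  have h2 := (Finset.sum_le_sum fun j (_ : j ∈ Finset.univ.filter
    fun j => P (insert j (insert i Λ)) ≠ 0) => le_abs_self (a j))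
  linarith

end influence

/-- The exponent of the trace exponential supermartingale, after the ones in `Λ` are revealed. -/
noncomputable def tiltedSum [Fintype ι] {m : Type*} (P : Finset ι → ℝ) (Y : ι → Matrix m m ℝ) (β γ : ℝ) (Λ : Finset ι) :
    Matrix m m ℝ :=
  ∑ j, (β * condMarginal P Λ j - if j ∈ Λ then γ else 0) • Y j

section step

variable [Fintype ι] {m : Type*} {P : Finset ι → ℝ} {Λ : Finset ι} {k D R β γ : ℝ}
  {Y : ι → Matrix m m ℝ}

theorem isHermitian_tiltedSum (hY : ∀ j, (Y j).PosSemidef) : (tiltedSum P Y β γ Λ).IsHermitian := by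
  rw [Matrix.IsHermitian, tiltedSum, Matrix.conjTranspose_sum]
  exact Finset.sum_congr rfl fun j _ => by
    rw [Matrix.conjTranspose_smul, (hY j).1.eq, star_trivial]

theorem sum_condMarginal_mul_trace_exp_le [Fintype m] [DecidableEq m] (hP0 : ∀ Λ, 0 ≤ P Λ) (hP : Antitone P)
    (hk : ∀ Λ, ∑ i, P (insert i Λ) = k * P Λ)
    (hD : ∀ Λ i, P (insert i Λ) ≠ 0 → ∑ j with P (insert j (insert i Λ)) ≠ 0,
      |condMarginal P (insert i Λ) j - condMarginal P Λ j| ≤ D) (hD0 : 0 ≤ D)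
    (hR : 0 < R) (hγ0 : 0 ≤ γ) (hKR : (2 * D * |β| + γ) * R ≤ 1)
    (hγ : (2 * D * |β| + γ) ^ 2 * R ≤ γ)
    (hY : ∀ j, (Y j).PosSemidef) (hYR : ∀ j, (R • (1 : Matrix m m ℝ) - Y j).PosSemidef)
    (hΛ : P Λ ≠ 0) :
    ∑ i ∈ Λᶜ, condMarginal P Λ i * (NormedSpace.exp (tiltedSum P Y β γ (insert i Λ))).trace ≤
      (k - Λ.card) * (NormedSpace.exp (tiltedSum P Y β γ Λ)).trace := by
  set p := condMarginal P Λ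
  set a : ι → ι → ℝ := fun i j => condMarginal P (insert i Λ) j - p j
  have hp0 : ∀ i, 0 ≤ p i := fun i => div_nonneg (hP0 _) (hP0 _)
  have hpne : ∀ i, p i ≠ 0 → P (insert i Λ) ≠ 0 := fun i h h' => h (by simp [p, condMarginal, h'])
  have hrow : ∀ i, p i ≠ 0 → ∑ j, |a i j| ≤ 2 * D := fun i h =>
    sum_abs_influence_le hP0 hk hΛ (hpne i h) (hD Λ i (hpne i h))
  have hsymm : ∀ i j, p i * a i j = p j * a j i := fun i j =>
    condMarginal_mul_influence_symm hP0 hP i j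
  have hsymm' : ∀ i j, p i * |a i j| = p j * |a j i| := fun i j => by
    have h := congrArg abs (hsymm i j)
    rwa [abs_mul, abs_mul, abs_of_nonneg (hp0 i), abs_of_nonneg (hp0 j)] at h
  have hcol : ∀ j, ∑ i, p i * |a i j| ≤ 2 * D * p j := fun j => by
    simp only [fun i => hsymm' i j, ← Finset.mul_sum]
    rcases eq_or_ne (p j) 0 with h | h
    · simp [h]
    · rw [mul_comm]; exact mul_le_mul_of_nonneg_right (hrow j h) (hp0 j)
  -- Marginals at revealed indices stay equal to 1, so the increment lives on `Λᶜ`.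
  have hmem : ∀ i, p i ≠ 0 → ∀ j ∈ Λ, a i j = 0 := fun i h j hj => by
    simp only [a, p]
    rw [condMarginal_of_mem hΛ hj,
      condMarginal_of_mem (hpne i h) (Finset.mem_insert_of_mem hj), sub_self]
  have hmem' : ∀ i ∈ Λ, ∀ j, a i j = 0 := fun i hi j => by
    simp only [a, p, Finset.insert_eq_of_mem hi, sub_self]
  -- Martingale property: reversibility turns the column sum into `p j` times a row sum, which
  -- vanishes.
  have hmean : ∀ j, ∑ i ∈ Λᶜ, p i * a i j = 0 := fun j => by
    rw [Finset.sum_subset (Finset.subset_univ _) fun i _ hi => by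
      rw [hmem' i (by simpa using hi), mul_zero]]
    simp only [fun i => hsymm i j, ← Finset.mul_sum]
    rcases eq_or_ne (p j) 0 with h | h
    · simp [h]
    · rw [Finset.sum_sub_distrib, sum_condMarginal hk hΛ, sum_condMarginal hk (hpne j h), sub_self,
        mul_zero]
  -- The change of the coefficient of `Y j` in `tiltedSum` when `i` is revealed.
  set c : ι → ι → ℝ := fun i j => β * a i j - if j = i then γ else 0
  have habs : ∀ i j, |c i j| ≤ |β| * |a i j| + if j = i then γ else 0 := fun i j => by
    refine (abs_sub _ _).trans_eq ?_
    rw [abs_mul]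
    split_ifs <;> simp [abs_of_nonneg hγ0]
  rw [← sum_compl_condMarginal hk hΛ]
  refine le_trans (le_of_eq (Finset.sum_congr rfl fun i hi => ?_))
    (Matrix.sum_mul_trace_exp_add_sum_smul_le (c := c) hR (by positivity) hKR hγ hY hYR
      (isHermitian_tiltedSum hY) (fun i _ => hp0 i) ?_ ?_ ?_)
  · rcases eq_or_ne (p i) 0 with h | h
    · simp [p, show condMarginal P Λ i = 0 from h]
    have hiΛ : i ∉ Λ := by simpa using hi
    congr 3
    rw [Finset.sum_subset (Finset.subset_univ Λᶜ), tiltedSum, tiltedSum, ← Finset.sum_add_distrib]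
    · refine Finset.sum_congr rfl fun j _ => ?_
      rw [← add_smul]
      congr 1
      simp only [c, a, p, Finset.mem_insert]
      by_cases hji : j = i
      · subst hji; simp [hiΛ]; ring
      · simp [hji]; ring
    · intro j _ hj
      have hj' : j ∈ Λ := by simpa using hj
      have hji : j ≠ i := fun h => hiΛ (h ▸ hj')
      simp [c, hmem i h j hj', hji]
  · intro i hi h
    calc ∑ j ∈ Λᶜ, |c i j| ≤ ∑ j, |c i j| :=
          Finset.sum_le_sum_of_subset_of_nonneg (Finset.subset_univ _) fun _ _ _ => abs_nonneg _
      _ ≤ ∑ j, (|β| * |a i j| + if j = i then γ else 0) := Finset.sum_le_sum fun j _ => habs i j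
      _ = |β| * ∑ j, |a i j| + γ := by
          rw [Finset.sum_add_distrib, ← Finset.mul_sum]; simp
      _ ≤ |β| * (2 * D) + γ := by gcongr; exact hrow i h
      _ = 2 * D * |β| + γ := by ring
  · intro j hj
    calc ∑ i ∈ Λᶜ, p i * |c i j| ≤ ∑ i, p i * |c i j| :=
          Finset.sum_le_sum_of_subset_of_nonneg (Finset.subset_univ _) fun i _ _ =>
            mul_nonneg (hp0 i) (abs_nonneg _)
      _ ≤ ∑ i, (|β| * (p i * |a i j|) + if j = i then γ * p i else 0) := by
          refine Finset.sum_le_sum fun i _ => ?_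
          refine (mul_le_mul_of_nonneg_left (habs i j) (hp0 i)).trans_eq ?_
          split_ifs <;> ring
      _ = |β| * ∑ i, p i * |a i j| + γ * p j := by
          rw [Finset.sum_add_distrib, ← Finset.mul_sum]; simp
      _ ≤ |β| * (2 * D * p j) + γ * p j := by gcongr; exact hcol j
      _ = (2 * D * |β| + γ) * p j := by ring
  · intro j hj
    calc ∑ i ∈ Λᶜ, p i * c i j
        = ∑ i ∈ Λᶜ, (β * (p i * a i j) - if j = i then γ * p i else 0) := by
          refine Finset.sum_congr rfl fun i _ => ?_
          simp only [c]
          split_ifs <;> ring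
      _ = -γ * p j := by
          rw [Finset.sum_sub_distrib, ← Finset.mul_sum, hmean, Finset.sum_ite_eq, if_pos hj]
          ring

end step

end MatrixChernoff

/-! ### Revealing the ones of a homogeneous distribution -/

namespace MatrixChernoff

variable {n k : ℕ} {μ : Measure (Fin n → Bool)}

/-- The set of coordinates at which `ξ` is one. -/
def ones (ξ : Fin n → Bool) : Finset (Fin n) := Finset.univ.filter fun i => ξ i = true

theorem mem_ones {ξ : Fin n → Bool} {i : Fin n} : i ∈ ones ξ ↔ ξ i = true := by simp [ones]

theorem mem_allOnes {Λ : Finset (Fin n)} {ξ : Fin n → Bool} : ξ ∈ allOnes Λ ↔ Λ ⊆ ones ξ := by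
  simp [allOnes, Finset.subset_iff, mem_ones]

theorem ones_injective : Function.Injective (ones (n := n)) := fun ξ η h => by
  funext i
  have := Finset.ext_iff.1 h i
  rw [mem_ones, mem_ones] at this
  exact Bool.eq_iff_iff.2 this

theorem allOnes_empty : allOnes (∅ : Finset (Fin n)) = Set.univ := by simp [allOnes]

theorem allOnes_insert (i : Fin n) (Λ : Finset (Fin n)) :
    allOnes (insert i Λ) = allOnes Λ ∩ {ξ | ξ i = true} := by
  ext ξ; simp [allOnes, and_comm]

/-- The probability that all coordinates in `Λ` are one. -/
noncomputable def jointMarginal (μ : Measure (Fin n → Bool)) (Λ : Finset (Fin n)) : ℝ :=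
  μ.real (allOnes Λ)

theorem jointMarginal_nonneg (Λ : Finset (Fin n)) : 0 ≤ jointMarginal μ Λ := measureReal_nonneg

theorem jointMarginal_antitone [IsFiniteMeasure μ] : Antitone (jointMarginal μ) := fun _ _ h =>
  measureReal_mono fun _ hξ => mem_allOnes.2 (h.trans (mem_allOnes.1 hξ))

theorem jointMarginal_empty [IsProbabilityMeasure μ] : jointMarginal μ ∅ = 1 := by
  simp [jointMarginal, allOnes_empty]

/-- Each outcome is counted once for each of its ones, that is `k` times almost surely. -/
theorem sum_setIntegral_allOnes_insert [IsFiniteMeasure μ] (hk : IsHomogeneous μ k)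
    (f : (Fin n → Bool) → ℝ) (Λ : Finset (Fin n)) :
    ∑ i, ∫ ξ in allOnes (insert i Λ), f ξ ∂μ = k * ∫ ξ in allOnes Λ, f ξ ∂μ := by
  have h1 : ∀ i, ∫ ξ in allOnes (insert i Λ), f ξ ∂μ =
      ∫ ξ in allOnes Λ, (if ξ i = true then f ξ else 0) ∂μ := fun i => by
    rw [allOnes_insert, ← setIntegral_indicator (Set.toFinite _).measurableSet]
    congr 1 with ξ
    simp [Set.indicator_apply]
  simp only [h1]
  rw [← integral_finsetSum _ fun i _ => Integrable.of_finite, ← integral_const_mul]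
  refine setIntegral_congr_ae (Set.toFinite _).measurableSet (hk.mono fun ξ hξ _ => ?_)
  rw [← Finset.sum_filter, Finset.sum_const, hξ, nsmul_eq_mul]

theorem sum_jointMarginal_insert [IsFiniteMeasure μ] (hk : IsHomogeneous μ k)
    (Λ : Finset (Fin n)) : ∑ i, jointMarginal μ (insert i Λ) = k * jointMarginal μ Λ := by
  simpa [jointMarginal] using sum_setIntegral_allOnes_insert hk (fun _ => 1) Λ

/-- A function of sets that decreases in expectation when the next one is revealed decreases in
expectation when all ones are revealed. -/
theorem integral_comp_ones_le [IsProbabilityMeasure μ] (hk : IsHomogeneous μ k)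
    {F : Finset (Fin n) → ℝ}
    (hF : ∀ Λ, jointMarginal μ Λ ≠ 0 →
      ∑ i ∈ Λᶜ, condMarginal (jointMarginal μ) Λ i * F (insert i Λ) ≤ (k - Λ.card) * F Λ) :
    ∫ ξ, F (ones ξ) ∂μ ≤ F ∅ := by
  -- Backward induction, with `t` the number of ones still hidden.
  have key : ∀ t : ℕ, ∀ Λ : Finset (Fin n), Λ.card + t = k →
      ∫ ξ in allOnes Λ, F (ones ξ) ∂μ ≤ jointMarginal μ Λ * F Λ := by
    intro t
    induction t with
    | zero =>
      intro Λ hΛ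
      refine le_of_eq ?_
      have h : ∫ ξ in allOnes Λ, F (ones ξ) ∂μ = ∫ ξ in allOnes Λ, F Λ ∂μ := by
        refine setIntegral_congr_ae (Set.toFinite _).measurableSet (hk.mono fun ξ hξ hξΛ => ?_)
        rw [Finset.eq_of_subset_of_card_le (mem_allOnes.1 hξΛ) (le_of_eq ?_)]
        rw [ones, hξ, ← hΛ, add_zero]
      rw [h, setIntegral_const, smul_eq_mul]
      rfl
    | succ t ih =>
      intro Λ hΛ
      rcases eq_or_ne (jointMarginal μ Λ) 0 with h0 | h0
      · rw [h0, zero_mul, setIntegral_measure_zero]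
        exact (measureReal_eq_zero_iff).1 h0
      have hcard : (k : ℝ) - Λ.card = t + 1 := by rw [← hΛ]; push_cast; ring
      have h1 := sum_setIntegral_allOnes_insert hk (fun ξ => F (ones ξ)) Λ
      -- Indices in `Λ` contribute `Λ.card` copies of the integral; the rest carry the factor `k -
      -- Λ.card = t + 1`, which cancels at the end.
      rw [← Finset.sum_add_sum_compl Λ, Finset.sum_congr rfl fun i hi => by
        rw [Finset.insert_eq_of_mem hi], Finset.sum_const, nsmul_eq_mul] at h1
      have h2 : ∑ i ∈ Λᶜ, ∫ ξ in allOnes (insert i Λ), F (ones ξ) ∂μ ≤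
          jointMarginal μ Λ * ∑ i ∈ Λᶜ, condMarginal (jointMarginal μ) Λ i * F (insert i Λ) := by
        rw [Finset.mul_sum]
        refine Finset.sum_le_sum fun i hi => ?_
        rw [condMarginal, ← mul_assoc, mul_div_cancel₀ _ h0]
        refine ih _ ?_
        rw [Finset.card_insert_of_notMem (by simpa using hi)]
        omega
      have h3 := mul_le_mul_of_nonneg_left (hF Λ h0) (jointMarginal_nonneg (μ := μ) Λ)
      rw [hcard] at h3
      have h4 : ((t : ℝ) + 1) * ∫ ξ in allOnes Λ, F (ones ξ) ∂μ ≤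
          (t + 1) * (jointMarginal μ Λ * F Λ) := by
        rw [← hcard] at h3 ⊢
        linarith
      exact le_of_mul_le_mul_left h4 (by positivity)
  simpa [allOnes_empty, jointMarginal_empty] using key k ∅ (by simp)

theorem abs_condMarginal_sub_le [IsFiniteMeasure μ] {D : ℝ} (hD : IsLinftyIndependent μ D)
    (Λ : Finset (Fin n)) (i : Fin n) :
    ∑ j with jointMarginal μ (insert j (insert i Λ)) ≠ 0,
      |condMarginal (jointMarginal μ) (insert i Λ) j - condMarginal (jointMarginal μ) Λ j| ≤ D := by
  refine le_trans (Finset.sum_le_sum_of_subset_of_nonneg (Finset.filter_subset _ _)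
    (fun _ _ _ => abs_nonneg _) |>.trans' (le_of_eq (Finset.sum_congr rfl fun j hj => ?_))) (hD Λ i)
  have hj' : jointMarginal μ (insert j (insert i Λ)) ≠ 0 := (Finset.mem_filter.1 hj).2
  have hset : Λ ∪ {i, j} = insert j (insert i Λ) := by ext x; simp; tauto
  have hcond : ∀ Λ : Finset (Fin n), (cond μ (allOnes Λ)).real {ξ | ξ j = true} =
      condMarginal (jointMarginal μ) Λ j := fun Λ => by
    rw [measureReal_def, cond_apply (Set.toFinite _).measurableSet, ENNReal.toReal_mul,
      ENNReal.toReal_inv, condMarginal, div_eq_inv_mul, jointMarginal, jointMarginal,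
      allOnes_insert, measureReal_def, measureReal_def]
  have hne : μ (allOnes (Λ ∪ {i, j})) ≠ 0 := fun h => hj' (by
    rw [jointMarginal, ← hset, measureReal_def, h, ENNReal.toReal_zero])
  simp only [influenceMatrix, Matrix.of_apply, if_pos hne, hcond]

theorem ae_jointMarginal_ones_ne_zero [IsFiniteMeasure μ] : ∀ᵐ ξ ∂μ, jointMarginal μ (ones ξ) ≠ 0 := by
  rw [ae_iff_of_countable]
  intro ξ hξ h
  refine hξ (measure_mono_null ?_ ((measureReal_eq_zero_iff (by finiteness)).1 h))
  exact Set.singleton_subset_iff.2 (mem_allOnes.2 subset_rfl)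

theorem jointMarginal_eq_zero_of_card_lt (hk : IsHomogeneous μ k) {Λ : Finset (Fin n)}
    (hΛ : k < Λ.card) : jointMarginal μ Λ = 0 := by
  have h : μ (allOnes Λ) = 0 := by
    rw [measure_eq_zero_iff_ae_notMem]
    filter_upwards [hk] with ξ h hξ
    exact absurd (Finset.card_le_card (mem_allOnes.1 hξ)) (by rw [ones, h]; omega)
  rw [jointMarginal, measureReal_def, h, ENNReal.toReal_zero]

/-! ### The moment generating function, and small `D` -/

variable {d : ℕ} {Y : Fin n → Matrix (Fin d) (Fin d) ℝ}

theorem expectedSum_eq [IsFiniteMeasure μ] :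
    expectedSum μ Y = ∑ j, jointMarginal μ {j} • Y j := by
  ext a b
  simp only [expectedSum, matrixSum, Matrix.of_apply, Matrix.sum_apply, Matrix.smul_apply,
    smul_eq_mul]
  rw [integral_finsetSum _ fun i _ => Integrable.of_finite]
  refine Finset.sum_congr rfl fun j _ => ?_
  rw [integral_mul_const]
  congr 1
  have h : (fun ξ : Fin n → Bool => if ξ j = true then (1 : ℝ) else 0) =
      (allOnes {j}).indicator 1 := by
    funext ξ; simp [Set.indicator_apply, allOnes]
  rw [h, integral_indicator_one (Set.toFinite _).measurableSet, jointMarginal]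

theorem tiltedSum_empty [IsProbabilityMeasure μ] (β γ : ℝ) :
    tiltedSum (jointMarginal μ) Y β γ ∅ = β • expectedSum μ Y := by
  rw [tiltedSum, expectedSum_eq, Finset.smul_sum]
  refine Finset.sum_congr rfl fun j _ => ?_
  simp [condMarginal, jointMarginal_empty, smul_smul]

/-- Once all `k` ones are known no further one is possible, so the marginals are the indicator of
`ones ξ`. -/
theorem tiltedSum_ones [IsFiniteMeasure μ] (hk : IsHomogeneous μ k) (β γ : ℝ) :
    ∀ᵐ ξ ∂μ, tiltedSum (jointMarginal μ) Y β γ (ones ξ) = (β - γ) • matrixSum Y ξ := by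
  filter_upwards [hk, ae_jointMarginal_ones_ne_zero] with ξ hξ h0
  rw [tiltedSum, matrixSum, Finset.smul_sum]
  refine Finset.sum_congr rfl fun j _ => ?_
  rw [smul_smul]
  congr 1
  by_cases hj : ξ j = true
  · rw [condMarginal_of_mem h0 (mem_ones.2 hj), if_pos (mem_ones.2 hj), if_pos hj, mul_one, mul_one]
  · have hj' : j ∉ ones ξ := fun h => hj (mem_ones.1 h)
    have h : jointMarginal μ (insert j (ones ξ)) = 0 := by
      refine jointMarginal_eq_zero_of_card_lt hk ?_
      rw [Finset.card_insert_of_notMem hj', ones, hξ]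
      omega
    rw [condMarginal, h, if_neg hj', if_neg hj]
    simp

variable {D R θ : ℝ}

/-- The matrix moment generating function bound. -/
theorem integral_trace_exp_le [IsProbabilityMeasure μ] (hk : IsHomogeneous μ k)
    (hD : IsLinftyIndependent μ D) (hD2 : 1 / 2 ≤ D) (hR : 0 < R)
    (hY : ∀ i, (Y i).PosSemidef)
    (hYR : ∀ i, (R • (1 : Matrix (Fin d) (Fin d) ℝ) - Y i).PosSemidef)
    (hθ : |θ| * (D ^ 2 * R) ≤ 1 / 64) :
    ∫ ξ, (NormedSpace.exp (θ • matrixSum Y ξ)).trace ∂μ ≤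
      (NormedSpace.exp ((θ + 8 * θ ^ 2 * (D ^ 2 * R)) • expectedSum μ Y)).trace := by
  set γ := 8 * θ ^ 2 * (D ^ 2 * R)
  set T := |θ|
  have hT : 0 ≤ T := abs_nonneg _
  have hγ0 : 0 ≤ γ := by positivity
  have hγT : γ = 8 * T * (T * (D ^ 2 * R)) := by simp only [γ, T, ← sq_abs θ]; ring
  have hγ1 : γ ≤ T / 8 := by
    rw [hγT]; nlinarith
  -- Uses `D ≥ 1/2`: the first term is at most `9/4 * D * T`, and `γ ≤ T / 8 ≤ D * T / 4`. The
  -- square `25/4` of the constant stays below the 8 in `γ`.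
  have hK : 2 * D * |θ + γ| + γ ≤ 5 / 2 * (D * T) := by
    have h1 : |θ + γ| ≤ T + γ := (abs_add_le _ _).trans_eq (by rw [abs_of_nonneg hγ0])
    have h2 : 2 * D * |θ + γ| ≤ 2 * D * (T + T / 8) :=
      mul_le_mul_of_nonneg_left (by linarith) (by linarith)
    nlinarith
  have hK0 : 0 ≤ 2 * D * |θ + γ| + γ := by positivity
  have hKR : (2 * D * |θ + γ| + γ) * R ≤ 1 := by
    have h1 : (2 * D * |θ + γ| + γ) * R ≤ 5 / 2 * (D * T) * R :=
      mul_le_mul_of_nonneg_right hK hR.le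
    have h2 : D * (T * R) ≤ (2 * D ^ 2) * (T * R) :=
      mul_le_mul_of_nonneg_right (by nlinarith) (by positivity)
    nlinarith
  have hK2 : (2 * D * |θ + γ| + γ) ^ 2 * R ≤ γ := by
    have h1 : (2 * D * |θ + γ| + γ) ^ 2 * R ≤ (5 / 2 * (D * T)) ^ 2 * R := by gcongr
    have h2 : 0 ≤ T ^ 2 * (D ^ 2 * R) := by positivity
    have h3 : γ = 8 * (T ^ 2 * (D ^ 2 * R)) := by rw [hγT]; ring
    linarith
  have h := integral_comp_ones_le hk (F := fun Λ =>
    (NormedSpace.exp (tiltedSum (jointMarginal μ) Y (θ + γ) γ Λ)).trace) fun Λ hΛ =>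
      sum_condMarginal_mul_trace_exp_le jointMarginal_nonneg jointMarginal_antitone
        (sum_jointMarginal_insert hk) (fun Λ i _ => abs_condMarginal_sub_le hD Λ i) (by linarith)
        hR hγ0 hKR hK2 hY hYR hΛ
  rw [tiltedSum_empty] at h
  refine (integral_congr_ae ?_).trans_le h
  filter_upwards [tiltedSum_ones (Y := Y) hk (θ + γ) γ] with ξ hξ
  rw [hξ, add_sub_cancel_right]

/-- A homogeneous distribution with independence parameter below `1/2` is deterministic. -/
theorem ae_eq_const_of_lt_half [IsFiniteMeasure μ] (hk : IsHomogeneous μ k)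
    (hD : IsLinftyIndependent μ D) (hD2 : D < 1 / 2) {ξ η : Fin n → Bool} (hξ : μ {ξ} ≠ 0)
    (hη : μ {η} ≠ 0) : ξ = η := by
  have hcard : ∀ ξ, μ {ξ} ≠ 0 → (ones ξ).card = k := ae_iff_of_countable.1 hk
  -- Induction on a bound `t` for the number of ones of `ξ` not shared with `η`.
  suffices h : ∀ t : ℕ, ∀ ξ η, μ {ξ} ≠ 0 → μ {η} ≠ 0 → k ≤ (ones ξ ∩ ones η).card + t → ξ = η by
    exact h k ξ η hξ hη (Nat.le_add_left _ _)
  intro t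
  induction t with
  | zero =>
    intro ξ η hξ hη h
    have h1 : ones ξ ∩ ones η = ones ξ :=
      Finset.eq_of_subset_of_card_le Finset.inter_subset_left (by rw [hcard ξ hξ]; omega)
    have h2 : ones ξ ∩ ones η = ones η :=
      Finset.eq_of_subset_of_card_le Finset.inter_subset_right (by rw [hcard η hη]; omega)
    exact ones_injective (h1.symm.trans h2)
  | succ t ih =>
    intro ξ η hξ hη h
    rcases le_or_gt k (ones ξ ∩ ones η).card with hle | hlt
    · exact ih ξ η hξ hη (hle.trans (Nat.le_add_right _ _))
    set Λ := ones ξ ∩ ones η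
    have hpos : ∀ ζ Γ, μ {ζ} ≠ 0 → Γ ⊆ ones ζ → 0 < jointMarginal μ Γ := fun ζ Γ hζ hΓ => by
      refine ENNReal.toReal_pos (fun h0 => hζ (measure_mono_null ?_ h0)) (measure_ne_top _ _)
      exact Set.singleton_subset_iff.2 (mem_allOnes.2 hΓ)
    have hΛ : 0 < jointMarginal μ Λ := hpos ξ Λ hξ Finset.inter_subset_left
    -- The diagonal influence is `1 - condMarginal (jointMarginal μ) Λ i ≤ D < 1/2`, so every
    -- feasible `i` has conditional probability above one half.
    have hhalf : ∀ ζ i, μ {ζ} ≠ 0 → insert i Λ ⊆ ones ζ →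
        jointMarginal μ Λ < 2 * jointMarginal μ (insert i Λ) := fun ζ i hζ hi => by
      have h1 := hpos ζ _ hζ hi
      have h2 := abs_condMarginal_sub_le hD Λ i
      have h3 := (Finset.single_le_sum (f := fun j =>
        |condMarginal (jointMarginal μ) (insert i Λ) j - condMarginal (jointMarginal μ) Λ j|)
        (fun _ _ => abs_nonneg _) (Finset.mem_filter.2 ⟨Finset.mem_univ i, by
          rw [Finset.insert_eq_of_mem (Finset.mem_insert_self i Λ)]; exact h1.ne'⟩)).trans h2
      rw [condMarginal_of_mem h1.ne' (Finset.mem_insert_self i Λ)] at h3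
      have h4 : 1 / 2 < condMarginal (jointMarginal μ) Λ i := by
        linarith [le_abs_self (1 - condMarginal (jointMarginal μ) Λ i)]
      rw [condMarginal, lt_div_iff₀ hΛ] at h4
      linarith
    obtain ⟨i, hi, hiΛ⟩ : ∃ i ∈ ones ξ, i ∉ Λ := by
      by_contra! hc
      have := Finset.card_le_card (show ones ξ ⊆ Λ from hc)
      rw [hcard ξ hξ] at this; omega
    obtain ⟨j, hj, hjΛ⟩ : ∃ j ∈ ones η, j ∉ Λ := by
      by_contra! hc
      have := Finset.card_le_card (show ones η ⊆ Λ from hc)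
      rw [hcard η hη] at this; omega
    have hiξ : insert i Λ ⊆ ones ξ := Finset.insert_subset hi Finset.inter_subset_left
    have hjη : insert j Λ ⊆ ones η := Finset.insert_subset hj Finset.inter_subset_right
    -- Two events of conditional probability above one half meet. The outcome `ζ` shares more ones
    -- with each of `ξ` and `η` than they share with each other.
    obtain ⟨ζ, hζ, hζi, hζj⟩ : ∃ ζ, μ {ζ} ≠ 0 ∧ insert i Λ ⊆ ones ζ ∧ insert j Λ ⊆ ones ζ := by
      by_contra! hc
      have hnull : μ.real (allOnes (insert i Λ) ∩ allOnes (insert j Λ)) = 0 := by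
        rw [measureReal_eq_zero_iff, measure_eq_zero_iff_ae_notMem, ae_iff_of_countable]
        exact fun ζ hζ hmem => hc ζ hζ (mem_allOnes.1 hmem.1) (mem_allOnes.1 hmem.2)
      have hunion := measureReal_union_add_inter (μ := μ) (s := allOnes (insert i Λ))
        (t := allOnes (insert j Λ)) (Set.toFinite _).measurableSet
      have hle : μ.real (allOnes (insert i Λ) ∪ allOnes (insert j Λ)) ≤ jointMarginal μ Λ := by
        refine measureReal_mono (Set.union_subset ?_ ?_) <;>
          rw [allOnes_insert] <;> exact Set.inter_subset_left
      have h1 := hhalf ξ i hξ hiξ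
      have h2 := hhalf η j hη hjη
      simp only [jointMarginal] at h1 h2 hle
      linarith
    have grow : ∀ ω l, μ {ω} ≠ 0 → l ∉ Λ → insert l Λ ⊆ ones ω → insert l Λ ⊆ ones ζ → ω = ζ := by
      intro ω l hω hl hlω hlζ
      have hsub := Finset.card_le_card (Finset.subset_inter hlω hlζ)
      rw [Finset.card_insert_of_notMem hl] at hsub
      exact ih ω ζ hω hζ (by omega)
    exact (grow ξ i hξ hiΛ hiξ hζi).trans (grow η j hη hjΛ hjη hζj).symm

end MatrixChernoff

/-! ### Tail bounds -/

namespace MatrixChernoff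

variable {n k d : ℕ} {μ : Measure (Fin n → Bool)} {Y : Fin n → Matrix (Fin d) (Fin d) ℝ}
  {D R δ : ℝ}

theorem posSemidef_matrixSum (hY : ∀ i, (Y i).PosSemidef) (ξ : Fin n → Bool) :
    (matrixSum Y ξ).PosSemidef :=
  Matrix.posSemidef_sum _ fun i _ => (hY i).smul (by split_ifs <;> simp)

theorem posSemidef_expectedSum [IsFiniteMeasure μ] (hY : ∀ i, (Y i).PosSemidef) :
    (expectedSum μ Y).PosSemidef := by
  rw [expectedSum_eq]
  exact Matrix.posSemidef_sum _ fun i _ => (hY i).smul (jointMarginal_nonneg _)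

/-- Markov's inequality for the trace exponential. -/
theorem measureReal_le_of_exp_le_trace [IsProbabilityMeasure μ] {θ a b : ℝ} {s : Set (Fin n → Bool)}
    (hY : ∀ i, (Y i).PosSemidef)
    (hs : ∀ ξ ∈ s, Real.exp a ≤ (NormedSpace.exp (θ • matrixSum Y ξ)).trace)
    (hb : ∫ ξ, (NormedSpace.exp (θ • matrixSum Y ξ)).trace ∂μ ≤ d * Real.exp b) :
    μ.real s ≤ d * Real.exp (b - a) := by
  have hpos : ∀ ξ, 0 ≤ (NormedSpace.exp (θ • matrixSum Y ξ)).trace := fun ξ => by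
    rw [(posSemidef_matrixSum hY ξ).1.trace_exp_smul]
    exact Finset.sum_nonneg fun _ _ => (Real.exp_pos _).le
  have h := (mul_meas_ge_le_integral_of_nonneg (μ := μ) (ae_of_all _ hpos)
    Integrable.of_finite (Real.exp a)).trans hb
  have h2 : μ.real s ≤ μ.real {ξ | Real.exp a ≤ (NormedSpace.exp (θ • matrixSum Y ξ)).trace} :=
    measureReal_mono hs
  rw [Real.exp_sub, ← mul_div_assoc, le_div_iff₀ (Real.exp_pos a), mul_comm]
  exact (mul_le_mul_of_nonneg_left h2 (Real.exp_pos a).le).trans h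

/-- With `θ = δ / (64 L)` the coefficient of `δ² m / L` is `8/4096 - 1/64 = -7/512`, below `-1/128`.
-/
theorem chernoff_exponent_le {L m : ℝ} (hL : 0 < L) (hm : 0 ≤ m) (δ : ℝ) :
    (8 * (δ / (64 * L)) ^ 2 * L - δ / (64 * L) * δ) * m ≤ -(δ ^ 2 * m / (128 * L)) := by
  have h1 : (8 * (δ / (64 * L)) ^ 2 * L - δ / (64 * L) * δ) * m = -(7 / 512 * (δ ^ 2 * m / L)) := by
    field_simp; ring
  have h2 : δ ^ 2 * m / (128 * L) = 1 / 128 * (δ ^ 2 * m / L) := by field_simp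
  have h3 : 0 ≤ δ ^ 2 * m / L := by positivity
  rw [h1, h2]
  linarith

theorem lambdaMax_tail_le [IsProbabilityMeasure μ] (hd : 0 < d) (hk : IsHomogeneous μ k)
    (hD : IsLinftyIndependent μ D) (hD2 : 1 / 2 ≤ D) (hR : 0 < R)
    (hY : ∀ i, (Y i).PosSemidef)
    (hYR : ∀ i, (R • (1 : Matrix (Fin d) (Fin d) ℝ) - Y i).PosSemidef)
    (hδ0 : 0 ≤ δ) (hδ1 : δ ≤ 1) :
    μ.real {ξ | lambdaMax (matrixSum Y ξ) ≥ (1 + δ) * lambdaMax (expectedSum μ Y)} ≤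
      d * Real.exp (-(δ ^ 2 * lambdaMax (expectedSum μ Y) / (128 * (R * D ^ 2)))) := by
  set L := D ^ 2 * R
  have hL : 0 < L := by positivity
  set θ := δ / (64 * L)
  have hθ : 0 ≤ θ := by positivity
  have hθL : θ * L = δ / 64 := by simp only [θ]; field_simp
  have hE := posSemidef_expectedSum (μ := μ) hY
  have hmgf := integral_trace_exp_le (θ := θ) hk hD hD2 hR hY hYR
    (by rw [abs_of_nonneg hθ, hθL]; linarith)
  have h := measureReal_le_of_exp_le_trace hY
    (s := {ξ | lambdaMax (matrixSum Y ξ) ≥ (1 + δ) * lambdaMax (expectedSum μ Y)})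
    (a := θ * ((1 + δ) * lambdaMax (expectedSum μ Y)))
    (fun ξ hξ => (Real.exp_le_exp.2 (mul_le_mul_of_nonneg_left hξ hθ)).trans
      (exp_mul_lambdaMax_le_trace hd (posSemidef_matrixSum hY ξ).1 θ))
    (hmgf.trans (trace_exp_smul_le_lambdaMax hE.1 (by positivity)))
  refine h.trans (mul_le_mul_of_nonneg_left (Real.exp_le_exp.2 ?_) d.cast_nonneg)
  have h2 := chernoff_exponent_le hL (lambdaMax_nonneg hd hE) δ
  rw [mul_comm R]
  exact le_trans (le_of_eq (by ring)) h2

theorem lambdaMin_tail_le [IsProbabilityMeasure μ] (hd : 0 < d) (hk : IsHomogeneous μ k)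
    (hD : IsLinftyIndependent μ D) (hD2 : 1 / 2 ≤ D) (hR : 0 < R)
    (hY : ∀ i, (Y i).PosSemidef)
    (hYR : ∀ i, (R • (1 : Matrix (Fin d) (Fin d) ℝ) - Y i).PosSemidef)
    (hδ0 : 0 ≤ δ) (hδ1 : δ ≤ 1) :
    μ.real {ξ | lambdaMin (matrixSum Y ξ) ≤ (1 - δ) * lambdaMin (expectedSum μ Y)} ≤
      d * Real.exp (-(δ ^ 2 * lambdaMin (expectedSum μ Y) / (128 * (R * D ^ 2)))) := by
  set L := D ^ 2 * R
  have hL : 0 < L := by positivity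
  set θ := δ / (64 * L)
  have hθ : 0 ≤ θ := by positivity
  have hθL : θ * L = δ / 64 := by simp only [θ]; field_simp
  have hE := posSemidef_expectedSum (μ := μ) hY
  have hmgf := integral_trace_exp_le (θ := -θ) hk hD hD2 hR hY hYR
    (by rw [abs_neg, abs_of_nonneg hθ, hθL]; linarith)
  -- The multiplier of the mean must stay nonpositive for its smallest eigenvalue to dominate the
  -- trace.
  have hβ : -θ + 8 * (-θ) ^ 2 * L ≤ 0 := by
    have : -θ + 8 * (-θ) ^ 2 * L = θ * (8 * (θ * L) - 1) := by ring
    rw [this, hθL]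
    exact mul_nonpos_of_nonneg_of_nonpos hθ (by linarith)
  have h := measureReal_le_of_exp_le_trace hY
    (s := {ξ | lambdaMin (matrixSum Y ξ) ≤ (1 - δ) * lambdaMin (expectedSum μ Y)})
    (a := -θ * ((1 - δ) * lambdaMin (expectedSum μ Y)))
    (fun ξ hξ => (Real.exp_le_exp.2 (mul_le_mul_of_nonpos_left hξ (neg_nonpos.2 hθ))).trans
      (exp_mul_lambdaMin_le_trace hd (posSemidef_matrixSum hY ξ).1 (-θ)))
    (hmgf.trans (trace_exp_smul_le_lambdaMin hE.1 hβ))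
  refine h.trans (mul_le_mul_of_nonneg_left (Real.exp_le_exp.2 ?_) d.cast_nonneg)
  have h2 := chernoff_exponent_le hL (lambdaMin_nonneg hd hE) δ
  rw [mul_comm R]
  exact le_trans (le_of_eq (by ring)) h2

theorem ae_matrixSum_eq_expectedSum [IsProbabilityMeasure μ] (hk : IsHomogeneous μ k)
    (hD : IsLinftyIndependent μ D) (hD2 : D < 1 / 2) :
    ∀ᵐ ξ ∂μ, matrixSum Y ξ = expectedSum μ Y := by
  rw [ae_iff_of_countable]
  intro ξ hξ
  ext a b
  have h : ∀ᵐ η ∂μ, matrixSum Y η a b = matrixSum Y ξ a b := by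
    rw [ae_iff_of_countable]
    intro η hη
    rw [ae_eq_const_of_lt_half hk hD hD2 hη hξ]
  rw [expectedSum, Matrix.of_apply, integral_congr_ae h]
  simp

/-- The tail bound for an almost surely void event, unless the exponent vanishes. -/
theorem measureReal_le_mul_exp_of_ae [IsProbabilityMeasure μ] (hd : 0 < d) {s : Set (Fin n → Bool)}
    {m c : ℝ} (hm : 0 ≤ m) (hδ0 : 0 ≤ δ) (hs : ∀ᵐ ξ ∂μ, ξ ∈ s → δ * m ≤ 0) :
    μ.real s ≤ d * Real.exp (-(δ ^ 2 * m / c)) := by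
  rcases (mul_nonneg hδ0 hm).eq_or_lt with h | h
  · have h0 : δ ^ 2 * m = 0 := by rw [pow_two, mul_assoc, ← h, mul_zero]
    rw [h0, zero_div, neg_zero, Real.exp_zero, mul_one]
    exact measureReal_le_one.trans (by exact_mod_cast hd)
  · have h0 : μ s = 0 := by
      rw [measure_eq_zero_iff_ae_notMem]
      exact hs.mono fun ξ hξ hmem => h.not_ge (hξ hmem)
    rw [measureReal_def, h0, ENNReal.toReal_zero]
    positivity

end MatrixChernoff

theorem theorem1 :
    ∃ C : ℝ, 0 < C ∧
      ∀ (n k d : ℕ) (μ : MeasureTheory.Measure (Fin n → Bool))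
        (Y : Fin n → Matrix (Fin d) (Fin d) ℝ) (D R δ : ℝ),
        0 < d →
        MeasureTheory.IsProbabilityMeasure μ →
        MatrixChernoff.IsHomogeneous μ k →
        0 < D →
        MatrixChernoff.IsLinftyIndependent μ D →
        0 < R →
        (∀ i, (Y i).PosSemidef ∧ (R • (1 : Matrix (Fin d) (Fin d) ℝ) - Y i).PosSemidef) →
        0 ≤ δ → δ ≤ 1 →
        μ.real {ξ | MatrixChernoff.lambdaMin (MatrixChernoff.matrixSum Y ξ) ≤
              (1 - δ) * MatrixChernoff.lambdaMin (MatrixChernoff.expectedSum μ Y)} ≤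
            d * Real.exp (-(δ ^ 2 * MatrixChernoff.lambdaMin (MatrixChernoff.expectedSum μ Y) /
              (C * (R * D ^ 2)))) ∧
        μ.real {ξ | MatrixChernoff.lambdaMax (MatrixChernoff.matrixSum Y ξ) ≥
              (1 + δ) * MatrixChernoff.lambdaMax (MatrixChernoff.expectedSum μ Y)} ≤
            d * Real.exp (-(δ ^ 2 * MatrixChernoff.lambdaMax (MatrixChernoff.expectedSum μ Y) /
              (C * (R * D ^ 2)))) := by
  refine ⟨128, by norm_num, ?_⟩
  intro n k d μ Y D R δ hd hμ hk hD0 hD hR hY hδ0 hδ1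
  have hY1 : ∀ i, (Y i).PosSemidef := fun i => (hY i).1
  have hY2 : ∀ i, (R • (1 : Matrix (Fin d) (Fin d) ℝ) - Y i).PosSemidef := fun i => (hY i).2
  rcases le_or_gt (1 / 2) D with hD2 | hD2
  · exact ⟨MatrixChernoff.lambdaMin_tail_le hd hk hD hD2 hR hY1 hY2 hδ0 hδ1,
      MatrixChernoff.lambdaMax_tail_le hd hk hD hD2 hR hY1 hY2 hδ0 hδ1⟩
  -- The sum almost surely equals its mean, so either tail event forces `δ` times the extreme
  -- eigenvalue to be nonpositive.
  · have hdet := MatrixChernoff.ae_matrixSum_eq_expectedSum (Y := Y) hk hD hD2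
    have hE := MatrixChernoff.posSemidef_expectedSum (μ := μ) hY1
    constructor
    · refine MatrixChernoff.measureReal_le_mul_exp_of_ae hd
        (MatrixChernoff.lambdaMin_nonneg hd hE) hδ0 (hdet.mono fun ξ hξ hmem => ?_)
      rw [Set.mem_ofPred_eq, hξ] at hmem
      linarith
    · refine MatrixChernoff.measureReal_le_mul_exp_of_ae hd
        (MatrixChernoff.lambdaMax_nonneg hd hE) hδ0 (hdet.mono fun ξ hξ hmem => ?_)
      rw [Set.mem_ofPred_eq, hξ] at hmem
      linarith
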